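/- Let $H\in(0,\tfrac12)$, $\lambda>0$, $\sigma\in\mathbb{R}$, and let $B^H=(B^H_s)_{s\in\mathbb{R}}$ be a two-sided fractional Brownian motion with Hurst parameter $H$ on a probability space, i.e. a centered Gaussian process with almost surely continuous paths and covariance $\mathbb{E}[B^H_sB^H_t]=\tfrac12\left(|s|^{2H}+|t|^{2H}-|t-s|^{2H}\right)$. Let $X$ be the one-dimensional stationary fractional Ornstein–Uhlenbeck process $$X_t=\sigma\int_{-\infty}^t e^{-\lambda(t-s)}\,dB^H_s,\qquad t\ge 0,$$ where the integral is understood pathwise: almost surely, for all $t\ge0$, it is the limit as $a\to-\infty$ of the Riemann–Stieltjes (Young) integrals over $[a,t]$. Then for every $\alpha\in(0,H)$ there exist a constant $\beta\in(0,1)$ and a (finite, real-valued) random variable $C$, neither depending on $T$, such that almost surely, for all $T>0$ and all $s,t\in[0,T]$, $$|X_t-X_s|\le C\,T^{\beta}\,|t-s|^{\alpha}.$$ -/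

import Mathlib

open MeasureTheory ProbabilityTheory Filter Topology

/-- `B` is a two-sided fractional Brownian motion with Hurst parameter `H` under `P`: a centered
Gaussian process indexed by `ℝ`, with covariance `(|s|^{2H} + |t|^{2H} - |t - s|^{2H}) / 2` and
almost surely continuous paths. -/
structure IsFBM {Ω : Type*} [MeasurableSpace Ω] (P : Measure Ω) (H : ℝ) (B : ℝ → Ω → ℝ) :
    Prop where
  gaussian : IsGaussianProcess B P
  mean_zero : ∀ t, ∫ ω, B t ω ∂P = 0
  cov_eq : ∀ s t, cov[B s, B t; P] =
    (|s| ^ (2 * H) + |t| ^ (2 * H) - |t - s| ^ (2 * H)) / 2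
  continuous_paths : ∀ᵐ ω ∂P, Continuous (fun t ↦ B t ω)

/-- `I` is the (Riemann-Stieltjes, Young) integral `∫_a^b f dg`: the limit of the sums
`∑ f(ξ_i) (g(p_{i+1}) - g(p_i))` over all tagged partitions
`a = p_0 ≤ ξ_0 ≤ p_1 ≤ ξ_1 ≤ ⋯ ≤ p_n = b` as their mesh tends to `0`. -/
def HasStieltjesIntegral (f g : ℝ → ℝ) (a b I : ℝ) : Prop :=
  ∀ ε > 0, ∃ δ > 0, ∀ (n : ℕ) (p ξ : ℕ → ℝ), p 0 = a → p n = b →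
    (∀ i < n, p i ≤ ξ i ∧ ξ i ≤ p (i + 1) ∧ p (i + 1) - p i < δ) →
      |(∑ i ∈ Finset.range n, f (ξ i) * (g (p (i + 1)) - g (p i))) - I| < ε

/-- `I` is the improper integral `∫_{-∞}^b f dg = lim_{a → -∞} ∫_a^b f dg`. -/
def HasImproperStieltjesIntegral (f g : ℝ → ℝ) (b I : ℝ) : Prop :=
  ∃ J : ℝ → ℝ, (∀ a ≤ b, HasStieltjesIntegral f g a b (J a)) ∧ Tendsto J atBot (𝓝 I)

/-- `X` is (on `t ≥ 0`) the stationary fractional Ornstein-Uhlenbeck process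
`X_t = σ ∫_{-∞}^t e^{-λ(t-s)} dB_s` driven by the fractional Brownian motion `B` with Hurst
parameter `H`, the integral being understood pathwise. -/
structure IsStationaryFOU {Ω : Type*} [MeasurableSpace Ω] (P : Measure Ω) (H lam σ : ℝ)
    (B X : ℝ → Ω → ℝ) : Prop where
  fbm : IsFBM P H B
  eq_integral : ∀ᵐ ω ∂P, ∀ t, 0 ≤ t → ∃ I : ℝ,
    HasImproperStieltjesIntegral (fun s ↦ Real.exp (-lam * (t - s))) (fun s ↦ B s ω) t I ∧
      X t ω = σ * I

/-! The proof is deterministic once almost every path of `B` is known to be locally Hölder with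
exponent `α + b`, with a constant growing like `R ^ b` on `[-R, R]`; here `b` is small and becomes
`β`.

The growth bound is a weighted Kolmogorov–Chentsov argument (`IsFBM.exists_dyadic_bound`,
`exists_holder_bound_of_dyadic`): after division by weights polynomial in position, high moments of
all dyadic increments on the whole line are summable, so one random variable controls them.

For the process, the integral up to `t` is `exp (-lam * (t - s))` times the integral up to `s`, plus
an integral over `[s, t]`. Abel summation bounds the latter by the oscillation of the path. The
former changes by at most `lam * (t - s)` times its size, which is of order `(s + 1) ^ b` because
the kernel decays exponentially. The spare Hölder exponent `b` turns `(T + 1) ^ b` into `T ^ b` when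
`T` is small. -/

/-! ### Moments of the increments. -/

/-- The increments of a fractional Brownian motion are centered Gaussian with standard deviation
`|t - s| ^ H`. -/
lemma IsFBM.map_sub {Ω : Type*} [MeasurableSpace Ω] {P : Measure Ω} [IsProbabilityMeasure P]
    {H : ℝ} {B : ℝ → Ω → ℝ} (hH : 0 < H) (hB : IsFBM P H B) (s t : ℝ) :
    P.map (B t - B s) = (gaussianReal 0 1).map (fun x ↦ |t - s| ^ H * x) := by
  have hm : ∀ u, MemLp (B u) 2 P := fun u ↦ (hB.gaussian.hasGaussianLaw_eval u).memLp_two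
  have hvar : Var[B t - B s; P] = (|t - s| ^ H) ^ 2 := by
    rw [← covariance_self (((hm t).sub (hm s)).aemeasurable),
      covariance_sub_sub (hm t) (hm s) (hm t) (hm s),
      hB.cov_eq, hB.cov_eq, hB.cov_eq, hB.cov_eq, abs_sub_comm s t, ← Real.rpow_natCast,
      ← Real.rpow_mul (abs_nonneg _)]
    have h0 : (0 : ℝ) ^ (2 * H) = 0 := Real.zero_rpow (by positivity)
    simp only [sub_self, abs_zero, h0, Nat.cast_ofNat, mul_comm H 2]
    ring
  rw [(hB.gaussian.hasGaussianLaw_sub).map_eq_gaussianReal, hvar, gaussianReal_map_const_mul]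
  congr 1
  · have := integral_sub' ((hm t).integrable (by norm_num)) ((hm s).integrable (by norm_num))
    rw [this, hB.mean_zero, hB.mean_zero]
    simp
  · ext
    simp [Real.coe_toNNReal _ (sq_nonneg (|t - s| ^ H))]

lemma integrable_abs_pow_gaussianReal (p : ℕ) :
    Integrable (fun x : ℝ ↦ |x| ^ p) (gaussianReal 0 1) := by
  have := (memLp_id_gaussianReal' (μ := 0) (v := 1) (p : ENNReal) (by simp)).integrable_norm_pow'
  simpa using this

/-- Gaussian scaling gives every order `p`; arbitrarily large `p` is what allows an arbitrarily
small growth exponent `b`. -/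
lemma IsFBM.integrable_abs_sub_pow {Ω : Type*} [MeasurableSpace Ω] {P : Measure Ω}
    [IsProbabilityMeasure P] {H : ℝ} {B : ℝ → Ω → ℝ} (hH : 0 < H) (hB : IsFBM P H B)
    (s t : ℝ) (p : ℕ) :
    Integrable (fun ω ↦ |B t ω - B s ω| ^ p) P ∧
      ∫ ω, |B t ω - B s ω| ^ p ∂P =
        (|t - s| ^ H) ^ p * ∫ x, |x| ^ p ∂(gaussianReal 0 1) := by
  have hm : AEMeasurable (B t - B s) P :=
    (hB.gaussian.aemeasurable t).sub (hB.gaussian.aemeasurable s)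
  have hf : Continuous (fun x : ℝ ↦ |x| ^ p) := by fun_prop
  have hpow : ∀ x : ℝ, |(|t - s| ^ H * x)| ^ p = (|t - s| ^ H) ^ p * |x| ^ p := fun x ↦ by
    rw [abs_mul, mul_pow, abs_of_nonneg (by positivity : 0 ≤ |t - s| ^ H)]
  constructor
  · have h1 : Integrable (fun x : ℝ ↦ |x| ^ p) (P.map (B t - B s)) := by
      rw [hB.map_sub hH, integrable_map_measure hf.aestronglyMeasurable (by fun_prop)]
      simp only [Function.comp_def, hpow]
      exact (integrable_abs_pow_gaussianReal p).const_mul _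
    exact (integrable_map_measure hf.aestronglyMeasurable hm).1 h1
  · have h2 := integral_map hm (f := fun x : ℝ ↦ |x| ^ p) hf.aestronglyMeasurable
    simp only [Pi.sub_apply] at h2
    rw [← h2, hB.map_sub hH, integral_map (by fun_prop) hf.aestronglyMeasurable]
    simp only [hpow]
    exact integral_const_mul _ _

/-! ### Almost sure bounds on dyadic increments. -/

/-- Countably many nonnegative random variables with summable expectations are almost surely
dominated by a single random variable. -/
lemma exists_measurable_forall_le_of_summable_integral {Ω ι : Type*} [MeasurableSpace Ω]
    [Countable ι] {P : Measure Ω} {Y : ι → Ω → ℝ} (hY : ∀ i, Integrable (Y i) P)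
    (h0 : ∀ i ω, 0 ≤ Y i ω) (hs : Summable fun i ↦ ∫ ω, Y i ω ∂P) :
    ∃ M : Ω → ℝ, Measurable M ∧ (∀ ω, 0 ≤ M ω) ∧ ∀ᵐ ω ∂P, ∀ i, Y i ω ≤ M ω := by
  have hmeas : ∀ i, AEMeasurable (fun ω ↦ ENNReal.ofReal (Y i ω)) P :=
    fun i ↦ (hY i).aemeasurable.ennreal_ofReal
  have hZ : AEMeasurable (fun ω ↦ ∑' i, ENNReal.ofReal (Y i ω)) P := AEMeasurable.tsum hmeas
  have hfin : ∫⁻ ω, ∑' i, ENNReal.ofReal (Y i ω) ∂P ≠ ⊤ := by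
    rw [lintegral_tsum hmeas]
    have : ∀ i, ∫⁻ ω, ENNReal.ofReal (Y i ω) ∂P = ENNReal.ofReal (∫ ω, Y i ω ∂P) := fun i ↦
      (ofReal_integral_eq_lintegral_ofReal (hY i) (ae_of_all _ (h0 i))).symm
    simp only [this]
    exact hs.tsum_ofReal_ne_top
  refine ⟨fun ω ↦ (hZ.mk _ ω).toReal, hZ.measurable_mk.ennreal_toReal,
    fun ω ↦ ENNReal.toReal_nonneg, ?_⟩
  filter_upwards [ae_lt_top' hZ hfin, hZ.ae_eq_mk] with ω h1 h2 i
  rw [← h2, ← ENNReal.ofReal_le_iff_le_toReal h1.ne]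
  exact ENNReal.le_tsum i

lemma summable_one_add_abs_int_rpow {r : ℝ} (hr : r < -1) :
    Summable fun j : ℤ ↦ (1 + |(j : ℝ)|) ^ r := by
  have h : Summable fun n : ℕ ↦ (1 + (n : ℝ)) ^ r := by
    have := (summable_nat_add_iff 1).2 (Real.summable_nat_rpow.2 hr)
    simpa [add_comm] using this
  refine Summable.of_nat_of_neg ?_ ?_ <;> simpa using h

/-- Almost sure polynomial control of the dyadic increments of a fractional Brownian motion. -/
lemma IsFBM.exists_dyadic_bound {Ω : Type*} [MeasurableSpace Ω] {P : Measure Ω}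
    [IsProbabilityMeasure P] {H a b : ℝ} {B : ℝ → Ω → ℝ} (hH : 0 < H) (hB : IsFBM P H B)
    (ha : a < H) (hb : 0 < b) :
    ∃ M : Ω → ℝ, Measurable M ∧ (∀ ω, 0 ≤ M ω) ∧ ∀ᵐ ω ∂P, ∀ (k : ℕ) (j : ℤ),
      |B ((j + 1) / 2 ^ k) ω - B (j / 2 ^ k) ω| ≤
        M ω * (((2 : ℝ) ^ (-a)) ^ k * (1 + |(j : ℝ)|) ^ b) := by
  -- `b * p > 1` makes the sum over positions `j` converge; the sum over scales `k` is geometric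
  -- since `a < H`.
  obtain ⟨p, hp⟩ := exists_nat_gt (1 / b)
  have hbp : 1 < b * p := by
    rw [div_lt_iff₀ hb] at hp; linarith
  have hp0 : p ≠ 0 := by
    rintro rfl; simp at hbp; linarith
  set W : ℕ × ℤ → ℝ := fun i ↦ ((2 : ℝ) ^ (-a)) ^ i.1 * (1 + |(i.2 : ℝ)|) ^ b with hW
  have hWpos : ∀ i, 0 < W i := fun i ↦ by positivity
  set D : ℕ × ℤ → Ω → ℝ := fun i ω ↦ B ((i.2 + 1) / 2 ^ i.1) ω - B (i.2 / 2 ^ i.1) ω with hD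
  set c := ∫ x, |x| ^ p ∂(gaussianReal 0 1) with hc
  have hint : ∀ i, Integrable (fun ω ↦ |D i ω| ^ p / W i ^ p) P := fun i ↦
    (hB.integrable_abs_sub_pow hH _ _ p).1.div_const _
  have hval : ∀ i : ℕ × ℤ, ∫ ω, |D i ω| ^ p / W i ^ p ∂P =
      c * ((((2 : ℝ) ^ (a - H)) ^ p) ^ i.1 * (1 + |(i.2 : ℝ)|) ^ (-(b * p))) := fun i ↦ by
    have h1 : (|((i.2 : ℝ) + 1) / 2 ^ i.1 - i.2 / 2 ^ i.1|) ^ H = ((2 : ℝ) ^ (-H)) ^ i.1 := by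
      rw [← sub_div, add_sub_cancel_left, abs_of_nonneg (by positivity), one_div,
        Real.inv_rpow (by positivity), Real.rpow_neg (by norm_num), inv_pow,
        ← Real.rpow_natCast, ← Real.rpow_natCast, ← Real.rpow_mul (by norm_num),
        ← Real.rpow_mul (by norm_num), mul_comm]
    rw [integral_div, (hB.integrable_abs_sub_pow hH _ _ p).2, h1, hW]
    have h2 : (2 : ℝ) ^ (a - H) = 2 ^ (-H) / 2 ^ (-a) := by
      rw [← Real.rpow_sub (by norm_num)]; ring_nf
    have h3 : (1 + |(i.2 : ℝ)|) ^ (-(b * p)) = (((1 + |(i.2 : ℝ)|) ^ b) ^ p)⁻¹ := by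
      rw [Real.rpow_neg (by positivity), Real.rpow_mul_natCast (by positivity)]
    rw [h2, h3, div_pow, div_pow, mul_pow, ← pow_mul, ← pow_mul, ← pow_mul, ← pow_mul,
      mul_comm p i.1, ← hc]
    field_simp
  have hsum : Summable fun i ↦ ∫ ω, |D i ω| ^ p / W i ^ p ∂P := by
    simp only [hval]
    refine Summable.mul_left c ?_
    refine Summable.mul_of_nonneg (f := fun k : ℕ ↦ (((2 : ℝ) ^ (a - H)) ^ p) ^ k)
      (g := fun j : ℤ ↦ (1 + |(j : ℝ)|) ^ (-(b * p))) ?_ ?_ ?_ ?_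
    · refine summable_geometric_of_lt_one (by positivity) ?_
      exact pow_lt_one₀ (by positivity)
        (Real.rpow_lt_one_of_one_lt_of_neg (by norm_num) (by linarith)) hp0
    · exact summable_one_add_abs_int_rpow (by linarith)
    · intro k; positivity
    · intro j; positivity
  obtain ⟨M, hM, hM0, hle⟩ := exists_measurable_forall_le_of_summable_integral hint
    (fun i ω ↦ by have := hWpos i; positivity) hsum
  -- Since `M ≤ (1 + M) ^ p`, taking `1 + M` avoids a `p`-th root.
  refine ⟨fun ω ↦ 1 + M ω, hM.const_add 1, fun ω ↦ by linarith [hM0 ω], ?_⟩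
  filter_upwards [hle] with ω h k j
  have h1 := h (k, j)
  have h2 : |D (k, j) ω| ^ p ≤ ((1 + M ω) * W (k, j)) ^ p := by
    rw [div_le_iff₀ (pow_pos (hWpos _) _)] at h1
    rw [mul_pow]
    refine h1.trans ?_
    gcongr
    calc M ω ≤ 1 + M ω := by linarith
      _ ≤ (1 + M ω) ^ p := le_self_pow₀ (by linarith [hM0 ω]) hp0
  exact le_of_pow_le_pow_left₀ hp0 (mul_nonneg (by linarith [hM0 ω]) (hWpos (k, j)).le) h2

/-! ### Dyadic chaining. -/

lemma tendsto_floor_mul_two_pow_div (s : ℝ) :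
    Tendsto (fun m : ℕ ↦ (⌊s * 2 ^ m⌋ : ℝ) / 2 ^ m) atTop (𝓝 s) := by
  have h := tendsto_pow_atTop_atTop_of_one_lt (r := (2 : ℝ)) (by norm_num)
  have h2 : Tendsto (fun m : ℕ ↦ s - ((2 : ℝ) ^ m)⁻¹) atTop (𝓝 s) := by
    simpa using tendsto_const_nhds.sub h.inv_tendsto_atTop
  refine tendsto_of_tendsto_of_tendsto_of_le_of_le h2 tendsto_const_nhds (fun m ↦ ?_) fun m ↦ ?_
  · have := Int.lt_floor_add_one (s * 2 ^ m)
    have hp : (0 : ℝ) < 2 ^ m := by positivity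
    simp only
    rw [le_div_iff₀ hp, sub_mul, inv_mul_cancel₀ hp.ne']
    linarith
  · have hp : (0 : ℝ) < 2 ^ m := by positivity
    simp only
    rw [div_le_iff₀ hp]
    exact Int.floor_le _

/-- A continuous function whose dyadic increments are controlled is Hölder continuous at small
scales. -/
lemma exists_holder_bound_of_dyadic {a b : ℝ} (hb : 0 < b) (hba : b < a) :
    ∃ K : ℝ, 0 < K ∧ ∀ (g : ℝ → ℝ) (M : ℝ), Continuous g → 0 ≤ M →
      (∀ (k : ℕ) (j : ℤ), |g ((j + 1) / 2 ^ k) - g (j / 2 ^ k)| ≤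
        M * (((2 : ℝ) ^ (-a)) ^ k * (1 + |(j : ℝ)|) ^ b)) →
      ∀ R s t : ℝ, |s| ≤ R → |t| ≤ R → s ≤ t → t - s ≤ 1 →
        |g t - g s| ≤ K * M * (R + 3) ^ b * (t - s) ^ (a - b) := by
  set q : ℝ := 2 ^ (b - a) with hq
  have hq0 : 0 < q := by positivity
  have hq1 : q < 1 := Real.rpow_lt_one_of_one_lt_of_neg (by norm_num) (by linarith)
  have hqab : (2 : ℝ) ^ (-a) * 2 ^ b = q := by
    rw [← Real.rpow_add (by norm_num)]; ring_nf; rw [hq]; ring_nf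
  -- Two geometric tails and one middle increment; the division by `q` pays for rounding `t - s` to
  -- a dyadic scale.
  refine ⟨(2 / (1 - q) + 1) / q, by have := sub_pos.2 hq1; positivity, ?_⟩
  intro g M hg hM hdy R s t hs ht hst hst1
  set A := M * (R + 3) ^ b with hA
  have hR : 0 ≤ R := (abs_nonneg s).trans hs
  have hA0 : 0 ≤ A := by positivity
  -- Positions at level `k` reach size `R * 2 ^ k`, so the weight costs `2 ^ (k * b)` and the ratio
  -- `2 ^ (-a)` worsens to `q`. The slack `2` absorbs a doubled floor in `hstep`.
  have hinc : ∀ (k : ℕ) (j : ℤ), |(j : ℝ)| ≤ R * 2 ^ k + 2 →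
      |g ((j + 1) / 2 ^ k) - g (j / 2 ^ k)| ≤ A * q ^ k := fun k j hj ↦ by
    have h2 : (1 : ℝ) ≤ 2 ^ k := one_le_pow₀ (by norm_num)
    refine (hdy k j).trans ?_
    calc M * (((2 : ℝ) ^ (-a)) ^ k * (1 + |(j : ℝ)|) ^ b)
        ≤ M * (((2 : ℝ) ^ (-a)) ^ k * ((R + 3) * 2 ^ k) ^ b) := by
          gcongr
          nlinarith
      _ = A * q ^ k := by
        rw [← hqab, mul_pow, Real.mul_rpow (by positivity) (by positivity),
          ← Real.rpow_pow_comm (by norm_num : (0 : ℝ) ≤ 2) b]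
        simp only [hA]
        ring
  have hfloor : ∀ u : ℝ, |u| ≤ R → ∀ k : ℕ, |u * 2 ^ k| ≤ R * 2 ^ k := fun u hu k ↦ by
    rw [abs_mul, abs_of_pos (by positivity : (0 : ℝ) < 2 ^ k)]
    gcongr
  have hstep : ∀ u : ℝ, |u| ≤ R → ∀ m : ℕ,
      |g (⌊u * 2 ^ (m + 1)⌋ / 2 ^ (m + 1)) - g (⌊u * 2 ^ m⌋ / 2 ^ m)| ≤ A * q ^ (m + 1) := by
    intro u hu m
    have h1 : (⌊u * 2 ^ m⌋ : ℝ) / 2 ^ m = ((2 * ⌊u * 2 ^ m⌋ : ℤ) : ℝ) / 2 ^ (m + 1) := by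
      push_cast; rw [pow_succ]; field_simp
    have h2 := Int.floor_le (u * 2 ^ m)
    have h3 := Int.lt_floor_add_one (u * 2 ^ m)
    have h4 : 2 * ⌊u * 2 ^ m⌋ ≤ ⌊u * 2 ^ (m + 1)⌋ := by
      rw [Int.le_floor]; push_cast; rw [pow_succ]; linarith
    have h5 : ⌊u * 2 ^ (m + 1)⌋ < 2 * ⌊u * 2 ^ m⌋ + 2 := by
      rw [Int.floor_lt]; push_cast; rw [pow_succ]; linarith
    rw [h1]
    rcases (by omega : ⌊u * 2 ^ (m + 1)⌋ = 2 * ⌊u * 2 ^ m⌋ ∨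
      ⌊u * 2 ^ (m + 1)⌋ = 2 * ⌊u * 2 ^ m⌋ + 1) with h | h
    · rw [h]; simp; positivity
    · have h6 := hinc (m + 1) (2 * ⌊u * 2 ^ m⌋) (by
        have h7 := abs_le.1 (hfloor u hu m)
        push_cast
        rw [pow_succ, abs_le]
        constructor <;> linarith)
      rw [h]
      exact_mod_cast h6
  have htail : ∀ u : ℝ, |u| ≤ R → ∀ k : ℕ,
      |g u - g (⌊u * 2 ^ k⌋ / 2 ^ k)| ≤ A / (1 - q) * q ^ k := by
    intro u hu k
    have h1q : 0 < 1 - q := sub_pos.2 hq1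
    have hn : ∀ n : ℕ, |g (⌊u * 2 ^ (n + k)⌋ / 2 ^ (n + k)) - g (⌊u * 2 ^ k⌋ / 2 ^ k)| ≤
        A / (1 - q) * (q ^ k - q ^ (n + k)) := by
      intro n
      induction n with
      | zero => simp
      | succ n ih =>
        have h1 := hstep u hu (n + k)
        have h2 := abs_sub_le (g (⌊u * 2 ^ (n + k + 1)⌋ / 2 ^ (n + k + 1)))
          (g (⌊u * 2 ^ (n + k)⌋ / 2 ^ (n + k))) (g (⌊u * 2 ^ k⌋ / 2 ^ k))
        rw [show n + 1 + k = n + k + 1 by ring]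
        have h3 : A / (1 - q) * (q ^ k - q ^ (n + k + 1)) =
            A / (1 - q) * (q ^ k - q ^ (n + k)) + A * q ^ (n + k) := by
          rw [pow_succ]; field_simp; ring
        have h4 : A * q ^ (n + k + 1) ≤ A * q ^ (n + k) :=
          mul_le_mul_of_nonneg_left (pow_le_pow_of_le_one hq0.le hq1.le (Nat.le_succ _)) hA0
        linarith
    have hlim : Tendsto (fun n : ℕ ↦ |g (⌊u * 2 ^ (n + k)⌋ / 2 ^ (n + k)) -
        g (⌊u * 2 ^ k⌋ / 2 ^ k)|) atTop (𝓝 |g u - g (⌊u * 2 ^ k⌋ / 2 ^ k)|) :=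
      ((((hg.tendsto u).comp (tendsto_floor_mul_two_pow_div u)).comp
        (tendsto_add_atTop_nat k)).sub_const _).abs
    refine le_of_tendsto' hlim fun n ↦ (hn n).trans ?_
    have := pow_pos hq0 (n + k)
    gcongr
    linarith
  rcases hst.eq_or_lt with rfl | hlt
  · have := sub_pos.2 hq1
    simp only [sub_self, abs_zero]
    positivity
  -- At the scale `2 ^ (-(k + 1)) < t - s ≤ 2 ^ (-k)` the floors of `s` and `t` differ by at most
  -- one.
  obtain ⟨k, hk1, hk2⟩ := exists_nat_pow_near_of_lt_one (sub_pos.2 hlt) hst1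
    (by norm_num : (0 : ℝ) < 1 / 2) (by norm_num)
  have hp : (0 : ℝ) < 2 ^ k := by positivity
  have hmid : |g (⌊t * 2 ^ k⌋ / 2 ^ k) - g (⌊s * 2 ^ k⌋ / 2 ^ k)| ≤ A * q ^ k := by
    have h1 : ⌊s * 2 ^ k⌋ ≤ ⌊t * 2 ^ k⌋ := Int.floor_mono (by gcongr)
    have h2 : ⌊t * 2 ^ k⌋ ≤ ⌊s * 2 ^ k⌋ + 1 := by
      rw [← Int.floor_add_one]
      refine Int.floor_mono ?_
      rw [one_div, inv_pow, ← one_div, le_div_iff₀ hp] at hk2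
      linarith
    rcases (by omega : ⌊t * 2 ^ k⌋ = ⌊s * 2 ^ k⌋ ∨ ⌊t * 2 ^ k⌋ = ⌊s * 2 ^ k⌋ + 1) with h | h
    · rw [h]; simp; positivity
    · rw [h]
      have h6 := hinc k ⌊s * 2 ^ k⌋ (by
        have h7 := abs_le.1 (hfloor s hs k)
        have h8 := Int.floor_le (s * 2 ^ k)
        have h9 := Int.lt_floor_add_one (s * 2 ^ k)
        rw [abs_le]
        constructor <;> linarith)
      exact_mod_cast h6
  have hqk : q ^ k ≤ (t - s) ^ (a - b) / q := by
    rw [le_div_iff₀ hq0, ← pow_succ]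
    calc q ^ (k + 1) = ((1 / 2 : ℝ) ^ (k + 1)) ^ (a - b) := by
          rw [hq, ← Real.rpow_pow_comm (by norm_num), one_div, Real.inv_rpow (by norm_num),
            ← Real.rpow_neg (by norm_num), neg_sub]
      _ ≤ (t - s) ^ (a - b) := Real.rpow_le_rpow (by positivity) hk1.le (by linarith)
  have e1 := htail t ht k
  have e2 := htail s hs k
  rw [abs_sub_comm] at e2
  have e3 := abs_sub_le (g t) (g (⌊t * 2 ^ k⌋ / 2 ^ k)) (g s)
  have e4 := abs_sub_le (g (⌊t * 2 ^ k⌋ / 2 ^ k)) (g (⌊s * 2 ^ k⌋ / 2 ^ k)) (g s)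
  have h1q : 0 < 1 - q := sub_pos.2 hq1
  calc |g t - g s| ≤ (2 / (1 - q) + 1) * A * q ^ k := by
        have : (2 / (1 - q) + 1) * A * q ^ k =
          A / (1 - q) * q ^ k + (A * q ^ k + A / (1 - q) * q ^ k) := by ring
        linarith
    _ ≤ (2 / (1 - q) + 1) * A * ((t - s) ^ (a - b) / q) := by gcongr
    _ = _ := by rw [hA]; ring

/-! ### Riemann–Stieltjes sums and integrals. -/

/-- A sum `∑ f(ξ_i) (g(p_{i+1}) - g(p_i))` over a tagged partition with monotone bounded integrand
is controlled by the oscillation of `g`. -/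
lemma abs_riemannStieltjes_sum_le {f g : ℝ → ℝ} {a b F D : ℝ} (hf : Monotone f)
    (hf0 : ∀ x, 0 ≤ f x) (hF : ∀ x ≤ b, f x ≤ F) (hD0 : 0 ≤ D)
    (hD : ∀ u, a ≤ u → u ≤ b → |g u - g a| ≤ D)
    {n : ℕ} {p ξ : ℕ → ℝ} (hp0 : p 0 = a) (hpn : p n = b)
    (hξ : ∀ i < n, p i ≤ ξ i ∧ ξ i ≤ p (i + 1)) :
    |∑ i ∈ Finset.range n, f (ξ i) * (g (p (i + 1)) - g (p i))| ≤ 2 * F * D := by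
  have hF0 : 0 ≤ F := (hf0 b).trans (hF b le_rfl)
  have hstep : ∀ i < n, p i ≤ p (i + 1) := fun i hi ↦ (hξ i hi).1.trans (hξ i hi).2
  have hlow : ∀ i ≤ n, a ≤ p i := by
    intro i
    induction i with
    | zero => intro _; exact hp0.ge
    | succ i ih => intro hi; exact (ih (by omega)).trans (hstep i (by omega))
  have hupp : ∀ i ≤ n, p (n - i) ≤ b := by
    intro i
    induction i with
    | zero => intro _; exact hpn.le
    | succ i ih =>
      intro hi
      have := hstep (n - (i + 1)) (by omega)
      rw [show n - (i + 1) + 1 = n - i by omega] at this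
      exact this.trans (ih (by omega))
  have hG : ∀ i ≤ n, |g (p i) - g a| ≤ D := fun i hi ↦ hD _ (hlow i hi) (by
    simpa [Nat.sub_sub_self hi] using hupp (n - i) (Nat.sub_le _ _))
  rcases n with _ | n
  · simp; positivity
  -- Abel summation as an induction: replacing every weight by the last one costs `D` times the
  -- total increase of `f`.
  have key : ∀ m ≤ n, |(∑ i ∈ Finset.range (m + 1), f (ξ i) * (g (p (i + 1)) - g (p i))) -
      f (ξ m) * (g (p (m + 1)) - g a)| ≤ D * (f (ξ m) - f (ξ 0)) := by
    intro m
    induction m with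
    | zero => intro _; simp [hp0]
    | succ m ih =>
      intro hm
      rw [Finset.sum_range_succ]
      have hmono : f (ξ m) ≤ f (ξ (m + 1)) :=
        hf ((hξ m (by omega)).2.trans (hξ (m + 1) (by omega)).1)
      have h1 := abs_le.1 (ih (by omega))
      have h2 := abs_le.1 (hG (m + 1) (by omega))
      have h3 := mul_le_mul_of_nonneg_right h2.1 (sub_nonneg.2 hmono)
      have h4 := mul_le_mul_of_nonneg_right h2.2 (sub_nonneg.2 hmono)
      rw [abs_le]
      constructor <;> linarith
  have h1 := abs_le.1 (key n le_rfl)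
  have h2 := abs_le.1 (hG (n + 1) le_rfl)
  have hfn : f (ξ n) ≤ F := hF _ (by rw [← hpn]; exact (hξ n (by omega)).2)
  have h3 := mul_le_mul_of_nonneg_left h2.1 (hf0 (ξ n))
  have h4 := mul_le_mul_of_nonneg_left h2.2 (hf0 (ξ n))
  have h5 := mul_le_mul_of_nonneg_left hfn hD0
  have h6 := mul_nonneg hD0 (hf0 (ξ 0))
  rw [abs_le]
  constructor <;> linarith

/-- Bounds on sums pass to integrals only because partitions of arbitrarily small mesh exist. -/
lemma exists_tagged_partition {a b δ : ℝ} (hab : a ≤ b) (hδ : 0 < δ) :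
    ∃ (n : ℕ) (p : ℕ → ℝ), p 0 = a ∧ p n = b ∧
      ∀ i < n, p i ≤ p i ∧ p i ≤ p (i + 1) ∧ p (i + 1) - p i < δ := by
  obtain ⟨n, hn⟩ := exists_nat_gt ((b - a) / δ)
  have hn0 : (0 : ℝ) < n := lt_of_le_of_lt (div_nonneg (sub_nonneg.2 hab) hδ.le) hn
  refine ⟨n, fun i ↦ a + i * ((b - a) / n), by simp, by field_simp; ring, fun i _ ↦ ?_⟩
  have h0 : 0 ≤ (b - a) / n := div_nonneg (sub_nonneg.2 hab) hn0.le
  have h1 : (b - a) / n < δ := by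
    rw [div_lt_iff₀ hδ] at hn
    rw [div_lt_iff₀ hn0]; linarith
  push_cast
  refine ⟨le_rfl, by linarith, by linarith⟩

/-- Riemann-Stieltjes sums over `[a, c]` may be split at an intermediate point. -/
lemma HasStieltjesIntegral.exists_split {f g : ℝ → ℝ} {a b c I : ℝ}
    (h : HasStieltjesIntegral f g a c I) {ε : ℝ} (hε : 0 < ε) :
    ∃ δ > 0, ∀ (n m : ℕ) (p q ξ η : ℕ → ℝ), p 0 = a → p n = b → q 0 = b → q m = c →
      (∀ i < n, p i ≤ ξ i ∧ ξ i ≤ p (i + 1) ∧ p (i + 1) - p i < δ) →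
      (∀ i < m, q i ≤ η i ∧ η i ≤ q (i + 1) ∧ q (i + 1) - q i < δ) →
      |(∑ i ∈ Finset.range n, f (ξ i) * (g (p (i + 1)) - g (p i))) +
        (∑ i ∈ Finset.range m, f (η i) * (g (q (i + 1)) - g (q i))) - I| < ε := by
  obtain ⟨δ, hδ, H⟩ := h ε hε
  refine ⟨δ, hδ, fun n m p q ξ η hp0 hpn hq0 hqm hp hq ↦ ?_⟩
  -- At the junction `i = n` both branches give `b`.
  set P : ℕ → ℝ := fun i ↦ if i ≤ n then p i else q (i - n) with hP
  set Ξ : ℕ → ℝ := fun i ↦ if i < n then ξ i else η (i - n) with hΞ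
  have hPl : ∀ i ≤ n, P i = p i := fun i hi ↦ by simp [hP, hi]
  have hPr : ∀ i, P (n + i) = q i := fun i ↦ by
    rcases i with _ | i
    · simp [hP, hpn, hq0]
    · simp [hP]
  have hΞl : ∀ i < n, Ξ i = ξ i := fun i hi ↦ by simp [hΞ, hi]
  have hΞr : ∀ i, Ξ (n + i) = η i := fun i ↦ by simp [hΞ]
  have := H (n + m) P Ξ (by rw [hPl 0 (Nat.zero_le _), hp0]) (by rw [hPr, hqm]) (fun i hi ↦ by
    rcases lt_or_ge i n with hin | hin
    · rw [hPl i hin.le, hPl (i + 1) hin, hΞl i hin]; exact hp i hin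
    · obtain ⟨j, rfl⟩ := Nat.exists_eq_add_of_le hin
      rw [add_assoc, hPr, hPr, hΞr]; exact hq j (by omega))
  rw [Finset.sum_range_add] at this
  convert this using 4
  · refine Finset.sum_congr rfl fun i hi ↦ ?_
    have hi := Finset.mem_range.1 hi
    rw [hPl i hi.le, hPl (i + 1) hi, hΞl i hi]
  · refine Finset.sum_congr rfl fun i _ ↦ ?_
    rw [add_assoc, hPr, hPr, hΞr]

/-- Extending the interval of integration to the left. -/
lemma HasStieltjesIntegral.abs_sub_le_left {f g : ℝ → ℝ} {a b c I J F D : ℝ}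
    (hab : a ≤ b) (hbc : b ≤ c) (hf : Monotone f) (hf0 : ∀ x, 0 ≤ f x) (hF : ∀ x ≤ b, f x ≤ F)
    (hD0 : 0 ≤ D) (hD : ∀ u, a ≤ u → u ≤ b → |g u - g a| ≤ D)
    (hI : HasStieltjesIntegral f g a c I) (hJ : HasStieltjesIntegral f g b c J) :
    |I - J| ≤ 2 * F * D := by
  refine le_of_forall_pos_le_add fun ε hε ↦ ?_
  obtain ⟨δ₁, hδ₁, h₁⟩ := hI.exists_split (b := b) (half_pos hε)
  obtain ⟨δ₂, hδ₂, h₂⟩ := hJ (ε / 2) (half_pos hε)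
  obtain ⟨n, p, hp0, hpn, hp⟩ := exists_tagged_partition hab (lt_min hδ₁ hδ₂)
  obtain ⟨m, q, hq0, hqm, hq⟩ := exists_tagged_partition hbc (lt_min hδ₁ hδ₂)
  have e1 := abs_lt.1 (h₁ n m p q p q hp0 hpn hq0 hqm
    (fun i hi ↦ ⟨(hp i hi).1, (hp i hi).2.1, (hp i hi).2.2.trans_le (min_le_left _ _)⟩)
    (fun i hi ↦ ⟨(hq i hi).1, (hq i hi).2.1, (hq i hi).2.2.trans_le (min_le_left _ _)⟩))
  have e2 := abs_lt.1 (h₂ m q q hq0 hqm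
    (fun i hi ↦ ⟨(hq i hi).1, (hq i hi).2.1, (hq i hi).2.2.trans_le (min_le_right _ _)⟩))
  have e3 := abs_le.1 (abs_riemannStieltjes_sum_le hf hf0 hF hD0 hD hp0 hpn
    (fun i hi ↦ ⟨(hp i hi).1, (hp i hi).2.1⟩))
  rw [abs_le]
  constructor <;> linarith

/-- Extending the interval of integration to the right, with proportional integrands. -/
lemma HasStieltjesIntegral.abs_sub_le_right {f h g : ℝ → ℝ} {a b c I J F D r : ℝ}
    (hab : a ≤ b) (hbc : b ≤ c) (hf : Monotone f) (hf0 : ∀ x, 0 ≤ f x) (hF : ∀ x ≤ c, f x ≤ F)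
    (hD0 : 0 ≤ D) (hD : ∀ u, b ≤ u → u ≤ c → |g u - g b| ≤ D) (hr0 : 0 ≤ r) (hr1 : r ≤ 1)
    (hfh : ∀ x, f x = r * h x)
    (hI : HasStieltjesIntegral f g a c I) (hJ : HasStieltjesIntegral h g a b J) :
    |I - r * J| ≤ 2 * F * D := by
  refine le_of_forall_pos_le_add fun ε hε ↦ ?_
  obtain ⟨δ₁, hδ₁, h₁⟩ := hI.exists_split (b := b) (half_pos hε)
  obtain ⟨δ₂, hδ₂, h₂⟩ := hJ (ε / 2) (half_pos hε)
  obtain ⟨n, p, hp0, hpn, hp⟩ := exists_tagged_partition hab (lt_min hδ₁ hδ₂)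
  obtain ⟨m, q, hq0, hqm, hq⟩ := exists_tagged_partition hbc (lt_min hδ₁ hδ₂)
  have e1 := abs_lt.1 (h₁ n m p q p q hp0 hpn hq0 hqm
    (fun i hi ↦ ⟨(hp i hi).1, (hp i hi).2.1, (hp i hi).2.2.trans_le (min_le_left _ _)⟩)
    (fun i hi ↦ ⟨(hq i hi).1, (hq i hi).2.1, (hq i hi).2.2.trans_le (min_le_left _ _)⟩))
  have e2 := h₂ n p p hp0 hpn
    (fun i hi ↦ ⟨(hp i hi).1, (hp i hi).2.1, (hp i hi).2.2.trans_le (min_le_right _ _)⟩)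
  have e3 := abs_le.1 (abs_riemannStieltjes_sum_le hf hf0 hF hD0 hD hq0 hqm
    (fun i hi ↦ ⟨(hq i hi).1, (hq i hi).2.1⟩))
  have e4 : ∑ i ∈ Finset.range n, f (p i) * (g (p (i + 1)) - g (p i)) =
      r * ∑ i ∈ Finset.range n, h (p i) * (g (p (i + 1)) - g (p i)) := by
    rw [Finset.mul_sum]
    exact Finset.sum_congr rfl fun i _ ↦ by rw [hfh, mul_assoc]
  rw [e4] at e1
  have e5 := abs_lt.1 (calc
    |r * ∑ i ∈ Finset.range n, h (p i) * (g (p (i + 1)) - g (p i)) - r * J|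
      = r * |∑ i ∈ Finset.range n, h (p i) * (g (p (i + 1)) - g (p i)) - J| := by
        rw [← mul_sub, abs_mul, abs_of_nonneg hr0]
    _ ≤ |∑ i ∈ Finset.range n, h (p i) * (g (p (i + 1)) - g (p i)) - J| :=
        mul_le_of_le_one_left (abs_nonneg _) hr1
    _ < ε / 2 := e2)
  rw [abs_le]
  constructor <;> linarith

/-! ### Pathwise estimates for the Ornstein–Uhlenbeck integral. -/

lemma monotone_exp_neg_mul_sub {lam : ℝ} (hlam : 0 < lam) (t : ℝ) :
    Monotone fun s : ℝ ↦ Real.exp (-lam * (t - s)) := fun x y hxy ↦ by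
  simp only
  exact Real.exp_le_exp.2 (by nlinarith)

lemma summable_exp_mul_add_four {lam : ℝ} (hlam : 0 < lam) :
    Summable fun n : ℕ ↦ Real.exp (-lam * n) * (n + 4) := by
  have h1 := Real.summable_pow_mul_exp_neg_nat_mul 1 hlam
  have h2 := (Real.summable_pow_mul_exp_neg_nat_mul 0 hlam).mul_left 4
  refine (h1.add h2).congr fun n ↦ ?_
  ring

lemma HasStieltjesIntegral.eq_zero_of_self {f g : ℝ → ℝ} {a I : ℝ}
    (h : HasStieltjesIntegral f g a a I) : I = 0 := by
  by_contra hI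
  obtain ⟨δ, hδ, H⟩ := h |I| (abs_pos.2 hI)
  -- The partition with `n = 0` is admissible and its sum is empty.
  simpa using H 0 (fun _ ↦ a) (fun _ ↦ a) rfl rfl (by simp)

/-- `g` is locally `c`-Hölder, with a constant growing at most like the power `b` of the distance
to the origin. -/
def HasHolderGrowth (g : ℝ → ℝ) (M b c : ℝ) : Prop :=
  ∀ R s t : ℝ, |s| ≤ R → |t| ≤ R → s ≤ t → t - s ≤ 1 →
    |g t - g s| ≤ M * (R + 3) ^ b * (t - s) ^ c

/-- Cut the past into unit blocks. On the `N`-th the kernel is at most `exp (-lam * N)`, and `s + N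
+ 4 ≤ (s + 1) * (N + 4)` separates the growth in `s` from a convergent series in `N`. -/
lemma HasImproperStieltjesIntegral.abs_le_of_hasHolderGrowth {lam b c M s I : ℝ} {g : ℝ → ℝ}
    (hlam : 0 < lam) (hb0 : 0 ≤ b) (hb1 : b ≤ 1) (hc : 0 ≤ c) (hM : 0 ≤ M)
    (hg : HasHolderGrowth g M b c) (hs : 0 ≤ s)
    (hI : HasImproperStieltjesIntegral (fun u ↦ Real.exp (-lam * (s - u))) g s I) :
    |I| ≤ 2 * (∑' n : ℕ, Real.exp (-lam * n) * (n + 4)) * M * (s + 1) ^ b := by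
  obtain ⟨J, hJ, hlim⟩ := hI
  have hsum := summable_exp_mul_add_four hlam
  have hbound : ∀ N : ℕ, |J (s - N)| ≤
      2 * (∑ n ∈ Finset.range N, Real.exp (-lam * n) * (n + 4)) * M * (s + 1) ^ b := by
    intro N
    induction N with
    | zero =>
      have := (hJ s le_rfl).eq_zero_of_self
      simp [this]
    | succ N ih =>
      have hN : (0 : ℝ) ≤ N := Nat.cast_nonneg N
      have hstep : |J (s - (N + 1 : ℕ)) - J (s - N)| ≤
          2 * Real.exp (-lam * N) * (M * ((s + 1) ^ b * (N + 4))) := by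
        refine HasStieltjesIntegral.abs_sub_le_left (b := s - N) (by push_cast; linarith)
          (by linarith) (monotone_exp_neg_mul_sub hlam s) (fun x ↦ (Real.exp_pos _).le)
          (fun x hx ↦ ?_) (by positivity) (fun u hu1 hu2 ↦ ?_)
          (hJ _ (by push_cast; linarith)) (hJ _ (by linarith))
        · have := monotone_exp_neg_mul_sub hlam s hx
          simpa using this
        · push_cast at hu1 ⊢
          refine (hg (s + N + 1) _ _ ?_ ?_ hu1 (by linarith)).trans ?_
          · rw [abs_le]; constructor <;> linarith
          · rw [abs_le]; constructor <;> linarith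
          · rw [mul_assoc]
            gcongr M * ?_
            have h1 : (u - (s - (N + 1))) ^ c ≤ 1 :=
              Real.rpow_le_one (by linarith) (by linarith) hc
            have h2 : (s + N + 1 + 3) ^ b ≤ (s + 1) ^ b * (N + 4) := calc
              (s + N + 1 + 3) ^ b ≤ ((s + 1) * (N + 4)) ^ b := by
                gcongr
                nlinarith
              _ = (s + 1) ^ b * ((N : ℝ) + 4) ^ b :=
                Real.mul_rpow (by linarith) (by linarith)
              _ ≤ (s + 1) ^ b * (N + 4) := by
                gcongr
                exact Real.rpow_le_self_of_one_le (by linarith) hb1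
            exact (mul_le_of_le_one_right (by positivity) h1).trans h2
      have h1 := abs_sub_abs_le_abs_sub (J (s - (N + 1 : ℕ))) (J (s - N))
      rw [Finset.sum_range_succ]
      linarith
  have hlim' : Tendsto (fun N : ℕ ↦ |J (s - N)|) atTop (𝓝 |I|) := by
    refine (hlim.comp ?_).abs
    have := tendsto_atBot_add_const_left atTop s
      (tendsto_neg_atTop_atBot.comp (tendsto_natCast_atTop_atTop (R := ℝ)))
    simpa [Function.comp_def, sub_eq_add_neg] using this
  refine le_of_tendsto' hlim' fun N ↦ (hbound N).trans ?_
  gcongr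
  exact hsum.sum_le_tsum _ fun n _ ↦ by positivity

/-- The kernels are proportional, so the past before `s` cancels, leaving an integral over `[s, t]`
with integrand at most `1`; the bound is uniform in the lower limit. -/
lemma HasImproperStieltjesIntegral.abs_sub_mul_le {lam b c M s t Is It : ℝ} {g : ℝ → ℝ}
    (hlam : 0 < lam) (hc : 0 ≤ c) (hM : 0 ≤ M) (hg : HasHolderGrowth g M b c)
    (hs : 0 ≤ s) (hst : s ≤ t) (hst1 : t - s ≤ 1)
    (hIs : HasImproperStieltjesIntegral (fun u ↦ Real.exp (-lam * (s - u))) g s Is)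
    (hIt : HasImproperStieltjesIntegral (fun u ↦ Real.exp (-lam * (t - u))) g t It) :
    |It - Real.exp (-lam * (t - s)) * Is| ≤ 2 * (M * (t + 3) ^ b * (t - s) ^ c) := by
  obtain ⟨J, hJ, hJlim⟩ := hIs
  obtain ⟨L, hL, hLlim⟩ := hIt
  have hlim := (hLlim.sub (hJlim.const_mul (Real.exp (-lam * (t - s))))).abs
  refine le_of_tendsto hlim ?_
  filter_upwards [eventually_le_atBot s] with a ha
  have ht : 0 ≤ t := hs.trans hst
  have hts : 0 ≤ t - s := sub_nonneg.2 hst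
  have := HasStieltjesIntegral.abs_sub_le_right (F := 1) (D := M * (t + 3) ^ b * (t - s) ^ c)
    (r := Real.exp (-lam * (t - s))) ha hst
    (monotone_exp_neg_mul_sub hlam t) (fun x ↦ (Real.exp_pos _).le) (fun x hx ↦ by
      simpa using monotone_exp_neg_mul_sub hlam t hx) (by positivity)
    (fun u hu1 hu2 ↦ by
      refine (hg t s u (abs_le.2 ⟨by linarith, hst⟩) (abs_le.2 ⟨by linarith, hu2⟩) hu1
        (by linarith)).trans ?_
      have := sub_nonneg.2 hu1
      gcongr) (Real.exp_pos _).le (Real.exp_le_one_iff.2 (by nlinarith))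
    (fun x ↦ by rw [← Real.exp_add]; ring_nf) (hL a (ha.trans hst)) (hJ a ha)
  simpa using this

/-- Pathwise Hölder estimate for the stationary solution of a Langevin equation. -/
lemma exists_holder_bound_ornsteinUhlenbeck {lam α b : ℝ} (hlam : 0 < lam) (hα : 0 < α)
    (hb : 0 < b) (hb1 : b ≤ 1) (hαb : α + b ≤ 1) :
    ∃ K : ℝ, 0 ≤ K ∧ ∀ (g I : ℝ → ℝ) (M : ℝ), 0 ≤ M → HasHolderGrowth g M b (α + b) →
      (∀ t, 0 ≤ t →
        HasImproperStieltjesIntegral (fun u ↦ Real.exp (-lam * (t - u))) g t (I t)) →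
      ∀ T s t : ℝ, 0 ≤ s → s ≤ t → t ≤ T → |I t - I s| ≤ K * M * T ^ b * (t - s) ^ α := by
  set S := ∑' n : ℕ, Real.exp (-lam * n) * (n + 4) with hS
  have hS0 : 0 ≤ S := tsum_nonneg fun n ↦ by positivity
  -- `6` comes from `[s, t]`, `2 * lam * S` from the damped past, `4 * S` from the case `t - s > 1`,
  -- and the factor `2` from trading `T + 1` for `T`.
  refine ⟨2 * (6 + 2 * lam * S + 4 * S), by positivity, ?_⟩
  intro g I M hM hg hI T s t hs hst htT
  rcases hst.eq_or_lt with rfl | hlt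
  · simp [hα.ne']
  have hts : 0 < t - s := sub_pos.2 hlt
  have hT : 0 < T := by linarith
  have hIs := (hI s hs).abs_le_of_hasHolderGrowth hlam hb.le hb1 (by positivity) hM hg hs
  have hIt := (hI t (by linarith)).abs_le_of_hasHolderGrowth hlam hb.le hb1 (by positivity) hM hg
    (by linarith)
  rw [← hS] at hIs hIt
  have hIs' : |I s| ≤ 2 * S * M * (T + 1) ^ b := hIs.trans (by gcongr; linarith)
  have hIt' : |I t| ≤ 2 * S * M * (T + 1) ^ b := hIt.trans (by gcongr; linarith)
  have hfar : |I t - I s| ≤ 4 * S * M * (T + 1) ^ b := by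
    have := abs_sub (I t) (I s)
    linarith
  have hnear : t - s ≤ 1 →
      |I t - I s| ≤ (6 + 2 * lam * S) * M * (T + 1) ^ b * (t - s) ^ (α + b) := by
    intro h1
    have e1 := (hI s hs).abs_sub_mul_le hlam (by positivity) hM hg hs hst h1 (hI t (by linarith))
    have e2 : (t + 3) ^ b ≤ 3 * (T + 1) ^ b := calc
      (t + 3) ^ b ≤ (3 * (T + 1)) ^ b := Real.rpow_le_rpow (by linarith) (by linarith) hb.le
      _ = 3 ^ b * (T + 1) ^ b := Real.mul_rpow (by norm_num) (by linarith)
      _ ≤ 3 * (T + 1) ^ b := by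
        gcongr
        exact Real.rpow_le_self_of_one_le (by norm_num) hb1
    have e3 : 1 - Real.exp (-lam * (t - s)) ≤ lam * (t - s) ^ (α + b) := by
      have h2 := Real.add_one_le_exp (-lam * (t - s))
      have h3 : t - s ≤ (t - s) ^ (α + b) := Real.self_le_rpow_of_le_one hts.le h1 hαb
      nlinarith
    have e4 : 0 ≤ 1 - Real.exp (-lam * (t - s)) :=
      sub_nonneg.2 (Real.exp_le_one_iff.2 (by nlinarith))
    calc |I t - I s| = |(I t - Real.exp (-lam * (t - s)) * I s) -
          (1 - Real.exp (-lam * (t - s))) * I s| := by ring_nf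
      _ ≤ |I t - Real.exp (-lam * (t - s)) * I s| +
          |(1 - Real.exp (-lam * (t - s))) * I s| := abs_sub _ _
      _ = |I t - Real.exp (-lam * (t - s)) * I s| +
          (1 - Real.exp (-lam * (t - s))) * |I s| := by rw [abs_mul, abs_of_nonneg e4]
      _ ≤ 2 * (M * (3 * (T + 1) ^ b) * (t - s) ^ (α + b)) +
          lam * (t - s) ^ (α + b) * (2 * S * M * (T + 1) ^ b) := by
        refine add_le_add (e1.trans (by gcongr)) ?_
        gcongr
      _ = _ := by ring
  rcases le_or_gt T 1 with hT1 | hT1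
  · have h1 : (T + 1) ^ b ≤ 2 := calc
      (T + 1) ^ b ≤ T + 1 := Real.rpow_le_self_of_one_le (by linarith) hb1
      _ ≤ 2 := by linarith
    -- `(T + 1) ^ b` does not vanish as `T → 0`; the factor `T ^ b` comes from `t - s ≤ T` instead.
    have h2 : (t - s) ^ (α + b) ≤ T ^ b * (t - s) ^ α := by
      rw [Real.rpow_add hts, mul_comm]
      gcongr
      linarith
    calc |I t - I s| ≤ (6 + 2 * lam * S) * M * (T + 1) ^ b * (t - s) ^ (α + b) :=
          hnear (by linarith)
      _ ≤ (6 + 2 * lam * S + 4 * S) * M * 2 * (T ^ b * (t - s) ^ α) := by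
        gcongr ?_ * M * ?_ * ?_
        linarith
      _ = _ := by ring
  · have h1 : (T + 1) ^ b ≤ 2 * T ^ b := calc
      (T + 1) ^ b ≤ (2 * T) ^ b := by gcongr; linarith
      _ = 2 ^ b * T ^ b := Real.mul_rpow (by norm_num) hT.le
      _ ≤ 2 * T ^ b := by
        gcongr
        exact Real.rpow_le_self_of_one_le (by norm_num) hb1
    rcases le_or_gt (t - s) 1 with h | h
    · calc |I t - I s| ≤ (6 + 2 * lam * S) * M * (T + 1) ^ b * (t - s) ^ (α + b) := hnear h
        _ ≤ (6 + 2 * lam * S + 4 * S) * M * (2 * T ^ b) * (t - s) ^ α := by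
          have : (t - s) ^ (α + b) ≤ (t - s) ^ α :=
            Real.rpow_le_rpow_of_exponent_ge hts h (by linarith)
          gcongr ?_ * M * ?_ * ?_
          linarith
        _ = _ := by ring
    · have h2 : 1 ≤ (t - s) ^ α := Real.one_le_rpow h.le hα.le
      calc |I t - I s| ≤ 4 * S * M * (T + 1) ^ b * 1 := by rw [mul_one]; exact hfar
        _ ≤ (6 + 2 * lam * S + 4 * S) * M * (2 * T ^ b) * (t - s) ^ α := by
          gcongr
          have : 0 ≤ lam * S := by positivity
          linarith
        _ = _ := by ring

/-! ### Choice of exponents and conclusion. -/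

theorem mainTheorem10 {Ω : Type*} [MeasurableSpace Ω] (P : Measure Ω) [IsProbabilityMeasure P]
    (H : ℝ) (hH0 : 0 < H) (hH : H < 1 / 2) (lam : ℝ) (hlam : 0 < lam) (σ : ℝ)
    (B X : ℝ → Ω → ℝ) (hX : IsStationaryFOU P H lam σ B X) :
    ∀ α : ℝ, 0 < α → α < H →
      ∃ β : ℝ, 0 < β ∧ β < 1 ∧
        ∃ C : Ω → ℝ, Measurable C ∧
          ∀ᵐ ω ∂P, ∀ T : ℝ, 0 < T → ∀ s ∈ Set.Icc (0 : ℝ) T, ∀ t ∈ Set.Icc (0 : ℝ) T,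
            |X t ω - X s ω| ≤ C ω * T ^ β * |t - s| ^ α := by
  intro α hα hαH
  -- `α + 2 * b` is the midpoint of `α` and `H`. Chaining spends one `b`, small `T` the other.
  obtain ⟨b, hb⟩ : ∃ b, b = (H - α) / 4 := ⟨_, rfl⟩
  have hb0 : 0 < b := by linarith
  obtain ⟨M, hMm, hM0, hM⟩ := hX.fbm.exists_dyadic_bound hH0
    (by linarith : α + 2 * b < H) hb0
  obtain ⟨K, hK, hhol⟩ := exists_holder_bound_of_dyadic hb0 (by linarith : b < α + 2 * b)
  obtain ⟨K', hK', hou⟩ := exists_holder_bound_ornsteinUhlenbeck hlam hα hb0 (by linarith)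
    (by linarith)
  refine ⟨b, hb0, by linarith, fun ω ↦ |σ| * (K' * (K * M ω)),
    ((hMm.const_mul K).const_mul K').const_mul |σ|, ?_⟩
  filter_upwards [hM, hX.fbm.continuous_paths, hX.eq_integral] with ω hdy hcont hint
  choose! I hI hXI using hint
  have hg : HasHolderGrowth (fun s ↦ B s ω) (K * M ω) b (α + b) := by
    intro R s t hs ht hst h1
    have := hhol (fun s ↦ B s ω) (M ω) hcont (hM0 ω) hdy R s t hs ht hst h1
    rwa [show α + 2 * b - b = α + b by ring] at this
  have key : ∀ T s t : ℝ, 0 ≤ s → s ≤ t → t ≤ T →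
      |X t ω - X s ω| ≤ |σ| * (K' * (K * M ω)) * T ^ b * |t - s| ^ α := by
    intro T s t hs hst htT
    have := hou _ I (K * M ω) (mul_nonneg hK.le (hM0 ω)) hg hI T s t hs hst htT
    rw [hXI t (hs.trans hst), hXI s hs, ← mul_sub, abs_mul, abs_of_nonneg (sub_nonneg.2 hst)]
    calc |σ| * |I t - I s| ≤ |σ| * (K' * (K * M ω) * T ^ b * (t - s) ^ α) := by gcongr
      _ = _ := by ring
  intro T _ s hs t ht
  rcases le_total s t with h | h
  · exact key T s t hs.1 h ht.2
  · rw [abs_sub_comm (X t ω), abs_sub_comm t]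
    exact key T t s ht.1 h hs.2
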